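/- Let $C_b(\mathbb R,\mathbb C)$ be the space of bounded continuous functions $\mathbb R\to\mathbb C$ with the supremum norm. Let $\mathrm{AP}$ (the almost periodic functions) be the uniform closure in $C_b(\mathbb R,\mathbb C)$ of the set of all functions $Q(t)=\sum_{j=1}^n a_j e^{i\lambda_j t}$ with $n\ge 1$, $a_j\in\mathbb C$ and $\lambda_j\in\mathbb R$, and let $\mathrm{AP}^+$ be the uniform closure in $C_b(\mathbb R,\mathbb C)$ of the set of those $Q$ all of whose exponents satisfy $\lambda_j\ge 0$. Let $\mathbb C^+=\{z\in\mathbb C:\operatorname{Im} z>0\}$. Say that $f\in C_b(\mathbb R,\mathbb C)$ admits a bounded holomorphic extension to $\mathbb C^+$ if there is a continuous function $F$ on the closed half-plane $\mathbb C^+\cup\mathbb R$ that is holomorphic and bounded on $\mathbb C^+$ and satisfies $F(x)=f(x)$ for all $x\in\mathbb R$. Then $$\mathrm{AP}^+=\{f\in\mathrm{AP} : f \text{ admits a bounded holomorphic extension to } \mathbb C^+\}.$$ -/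

import Mathlib

open scoped BoundedContinuousFunction

/-- The generalized trigonometric polynomials `t ↦ ∑ j, a j * exp (i * freq j * t)`
with at least one term, complex coefficients and all frequencies in `Λ`,
as bounded continuous functions on `ℝ`. -/
def genTrigPoly (Λ : Set ℝ) : Set (ℝ →ᵇ ℂ) :=
  {Q | ∃ n : ℕ, 0 < n ∧ ∃ (a : Fin n → ℂ) (freq : Fin n → ℝ), (∀ j, freq j ∈ Λ) ∧
    ∀ t : ℝ, Q t = ∑ j, a j * Complex.exp (Complex.I * (freq j : ℂ) * (t : ℂ))}

/-- The almost periodic functions: the closure, for the supremum norm on `C_b(ℝ, ℂ)`,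
of the generalized trigonometric polynomials. -/
def AP : Set (ℝ →ᵇ ℂ) := closure (genTrigPoly Set.univ)

/-- The analytic trace of `AP`: the closure, for the supremum norm on `C_b(ℝ, ℂ)`,
of the generalized trigonometric polynomials with nonnegative frequencies. -/
def APPlus : Set (ℝ →ᵇ ℂ) := closure (genTrigPoly (Set.Ici 0))

/-- `f` is the boundary function of a bounded holomorphic function on the open upper half-plane:
some `F`, bounded and holomorphic on `Im z > 0`, is continuous on `Im z ≥ 0` and
equals `f` on the real line. -/
def HasBoundedHolomorphicExtension (f : ℝ →ᵇ ℂ) : Prop :=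
  ∃ F : ℂ → ℂ,
    DifferentiableOn ℂ F {z : ℂ | 0 < z.im} ∧
    (∃ M : ℝ, ∀ z : ℂ, 0 < z.im → ‖F z‖ ≤ M) ∧
    ContinuousOn F {z : ℂ | 0 ≤ z.im} ∧
    ∀ x : ℝ, F (x : ℂ) = f x

/-! A trigonometric polynomial with nonnegative frequencies extends boundedly to the upper
half-plane. By the maximum principle, extendability survives uniform limits
(`isClosed_hasBoundedHolomorphicExtension`).

Conversely, if `f` extends, its Bohr coefficients at negative frequencies vanish: shifting the
contour up gives exponential decay (`bohrMean_mul_expChar_eq_zero`). Bochner–Fejér sums of `f`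
therefore have only nonnegative frequencies. They are contractions, since their kernels are
nonnegative of mean one, and they nearly fix any prescribed characters when `B` is a Følner set
(`exists_folner_finset`). So they approximate every almost periodic `f`. -/

section AlmostPeriodic

open Filter Topology Complex

/-! ### Mean values -/

/-- The average of `f` over the interval `[0, R]`. -/
noncomputable def intervalMean (f : ℝ →ᵇ ℂ) (R : ℝ) : ℂ :=
  (R : ℂ)⁻¹ * ∫ s in (0 : ℝ)..R, f s

lemma norm_intervalMean_le (f : ℝ →ᵇ ℂ) (R : ℝ) : ‖intervalMean f R‖ ≤ ‖f‖ := by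
  have h := intervalIntegral.norm_integral_le_of_norm_le_const
    (f := fun s => f s) (a := 0) (b := R) (C := ‖f‖) fun s _ => f.norm_coe_le_norm s
  rw [intervalMean, norm_mul, norm_inv, norm_real, Real.norm_eq_abs]
  rcases eq_or_ne R 0 with rfl | hR
  · simp
  · rw [sub_zero] at h
    rw [inv_mul_le_iff₀ (abs_pos.2 hR), mul_comm]
    exact h

lemma intervalMean_add (f g : ℝ →ᵇ ℂ) (R : ℝ) :
    intervalMean (f + g) R = intervalMean f R + intervalMean g R := by
  simp only [intervalMean, BoundedContinuousFunction.coe_add, Pi.add_apply]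
  rw [intervalIntegral.integral_add (f.continuous.intervalIntegrable _ _)
    (g.continuous.intervalIntegrable _ _), mul_add]

lemma intervalMean_smul (c : ℂ) (f : ℝ →ᵇ ℂ) (R : ℝ) :
    intervalMean (c • f) R = c * intervalMean f R := by
  simp only [intervalMean, BoundedContinuousFunction.coe_smul, smul_eq_mul]
  rw [intervalIntegral.integral_const_mul]
  ring

/-- An ultrafilter on `ℝ` of neighbourhoods of `+∞`. -/
noncomputable def ultraTop : Ultrafilter ℝ := Ultrafilter.of atTop

lemma ultraTop_le : (ultraTop : Filter ℝ) ≤ atTop := Ultrafilter.of_le _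

/-- The averages stay in a compact ball, so an ultrafilter limit exists for every bounded continuous
function, and no convergence theorem for means is needed. -/
lemma exists_tendsto_intervalMean (f : ℝ →ᵇ ℂ) :
    ∃ c, Tendsto (intervalMean f) ultraTop (𝓝 c) := by
  obtain ⟨c, -, hc⟩ := (isCompact_closedBall (0 : ℂ) ‖f‖).ultrafilter_le_nhds
    (ultraTop.map (intervalMean f)) (by
      rw [le_principal_iff]
      refine Filter.mem_map.2 (Eventually.of_forall fun R : ℝ => ?_)
      simpa using norm_intervalMean_le f R)
  exact ⟨c, hc⟩

/-- A generalized Bohr mean: the limit of the averages over `[0, R]` along an ultrafilter. -/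
noncomputable def bohrMean : (ℝ →ᵇ ℂ) →ₗ[ℂ] ℂ where
  toFun f := (exists_tendsto_intervalMean f).choose
  map_add' f g := by
    refine tendsto_nhds_unique (exists_tendsto_intervalMean (f + g)).choose_spec ?_
    simp only [funext (intervalMean_add f g)]
    exact (exists_tendsto_intervalMean f).choose_spec.add
      (exists_tendsto_intervalMean g).choose_spec
  map_smul' c f := by
    refine tendsto_nhds_unique (exists_tendsto_intervalMean (c • f)).choose_spec ?_
    simp only [funext (intervalMean_smul c f)]
    exact (exists_tendsto_intervalMean f).choose_spec.const_mul c

lemma tendsto_intervalMean (f : ℝ →ᵇ ℂ) :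
    Tendsto (intervalMean f) ultraTop (𝓝 (bohrMean f)) :=
  (exists_tendsto_intervalMean f).choose_spec

lemma bohrMean_eq_of_tendsto {f : ℝ →ᵇ ℂ} {c : ℂ}
    (h : Tendsto (intervalMean f) atTop (𝓝 c)) : bohrMean f = c :=
  tendsto_nhds_unique (tendsto_intervalMean f) (h.mono_left ultraTop_le)

/-- The mean of a product with a nonnegative function is controlled by the mean of that function. -/
lemma norm_bohrMean_mul_le (f k : ℝ →ᵇ ℂ) (hk : ∀ s, k s = (‖k s‖ : ℂ)) :
    ‖bohrMean (f * k)‖ ≤ ‖f‖ * ‖bohrMean k‖ := by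
  refine le_of_tendsto_of_tendsto (tendsto_intervalMean (f * k)).norm
    ((tendsto_intervalMean k).norm.const_mul ‖f‖) ?_
  filter_upwards [ultraTop_le (eventually_gt_atTop 0)] with R hR
  have hint : (∫ s in (0 : ℝ)..R, k s) = ((∫ s in (0 : ℝ)..R, ‖k s‖ : ℝ) : ℂ) := by
    rw [← intervalIntegral.integral_ofReal]
    exact intervalIntegral.integral_congr fun s _ => hk s
  have hnn : 0 ≤ ∫ s in (0 : ℝ)..R, ‖k s‖ :=
    intervalIntegral.integral_nonneg hR.le fun s _ => norm_nonneg _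
  simp only [intervalMean, norm_mul, hint, norm_real, Real.norm_of_nonneg hnn]
  rw [mul_left_comm]
  refine mul_le_mul_of_nonneg_left ?_ (norm_nonneg _)
  rw [← intervalIntegral.integral_const_mul]
  refine intervalIntegral.norm_integral_le_of_norm_le hR.le (Eventually.of_forall fun s _ => ?_)
    ((continuous_const.mul k.continuous.norm).intervalIntegrable _ _)
  simpa using mul_le_mul_of_nonneg_right (f.norm_coe_le_norm s) (norm_nonneg (k s))

/-! ### Characters and trigonometric polynomials -/

/-- The function `t ↦ exp (i * lam * t)`. -/
noncomputable def expChar (lam : ℝ) : ℝ →ᵇ ℂ :=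
  BoundedContinuousFunction.ofNormedAddCommGroup (fun t : ℝ => exp (I * lam * t))
    (by fun_prop) 1 fun t => by simp [norm_exp]

lemma expChar_apply (lam t : ℝ) : expChar lam t = exp (I * lam * t) := rfl

lemma norm_expChar_apply (lam t : ℝ) : ‖expChar lam t‖ = 1 := by
  simp [expChar_apply, norm_exp]

lemma norm_expChar_le (lam : ℝ) : ‖expChar lam‖ ≤ 1 :=
  (BoundedContinuousFunction.norm_le zero_le_one).2 fun t => (norm_expChar_apply lam t).le

lemma expChar_mul (lam mu : ℝ) : expChar lam * expChar mu = expChar (lam + mu) := by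
  ext t
  simp only [BoundedContinuousFunction.coe_mul, Pi.mul_apply, expChar_apply, ← exp_add]
  congr 1
  push_cast
  ring

lemma expChar_zero : expChar 0 = 1 := by
  ext t
  simp [expChar_apply]

lemma star_expChar_apply (lam t : ℝ) : (starRingEnd ℂ) (expChar lam t) = expChar (-lam) t := by
  rw [expChar_apply, expChar_apply, ← exp_conj]
  simp

lemma expChar_apply_sub (lam t s : ℝ) :
    expChar lam (t - s) = expChar lam t * expChar (-lam) s := by
  simp only [expChar_apply, ← exp_add]
  congr 1
  push_cast
  ring

lemma bohrMean_one : bohrMean 1 = 1 := by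
  refine bohrMean_eq_of_tendsto (tendsto_const_nhds.congr' ?_)
  filter_upwards [eventually_ne_atTop 0] with R hR
  simp [intervalMean, hR]

lemma bohrMean_expChar_of_ne {lam : ℝ} (h : lam ≠ 0) : bohrMean (expChar lam) = 0 := by
  refine bohrMean_eq_of_tendsto ?_
  have hI : I * (lam : ℂ) ≠ 0 := by simp [h]
  have hinv : Tendsto (fun R : ℝ => R⁻¹ * (2 / |lam|)) atTop (𝓝 0) := by
    simpa using tendsto_inv_atTop_zero.mul_const (2 / |lam|)
  refine squeeze_zero_norm' ?_ hinv
  filter_upwards [eventually_gt_atTop 0] with R hR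
  simp only [intervalMean, expChar_apply]
  rw [integral_exp_mul_complex hI, norm_mul, norm_inv, norm_real, Real.norm_of_nonneg hR.le,
    norm_div]
  have h2 : ‖exp (I * lam * R) - exp (I * lam * (0 : ℝ))‖ ≤ 2 := by
    refine (norm_sub_le _ _).trans ?_
    simp [norm_exp]
    norm_num
  have h3 : ‖I * (lam : ℂ)‖ = |lam| := by simp
  rw [h3]
  gcongr

lemma bohrMean_expChar (lam : ℝ) : bohrMean (expChar lam) = if lam = 0 then 1 else 0 := by
  split_ifs with h
  · rw [h, expChar_zero, bohrMean_one]
  · exact bohrMean_expChar_of_ne h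

lemma sum_smul_expChar_apply {ι : Type*} (s : Finset ι) (a : ι → ℂ) (freq : ι → ℝ) (t : ℝ) :
    (∑ j ∈ s, a j • expChar (freq j)) t = ∑ j ∈ s, a j * exp (I * (freq j : ℂ) * (t : ℂ)) := by
  simp [BoundedContinuousFunction.coe_sum, expChar_apply]

lemma mem_genTrigPoly_iff {L : Set ℝ} {Q : ℝ →ᵇ ℂ} :
    Q ∈ genTrigPoly L ↔ ∃ n : ℕ, 0 < n ∧ ∃ (a : Fin n → ℂ) (freq : Fin n → ℝ),
      (∀ j, freq j ∈ L) ∧ Q = ∑ j, a j • expChar (freq j) := by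
  simp only [genTrigPoly, Set.mem_ofPred_eq, BoundedContinuousFunction.ext_iff,
    sum_smul_expChar_apply]

lemma sum_smul_expChar_mem_genTrigPoly {ι : Type*} [Fintype ι] [Nonempty ι] {L : Set ℝ}
    (a : ι → ℂ) (freq : ι → ℝ) (h : ∀ j, freq j ∈ L) :
    ∑ j, a j • expChar (freq j) ∈ genTrigPoly L := by
  refine mem_genTrigPoly_iff.2 ⟨Fintype.card ι, Fintype.card_pos,
    a ∘ (Fintype.equivFin ι).symm, freq ∘ (Fintype.equivFin ι).symm, fun j => h _, ?_⟩
  exact ((Fintype.equivFin ι).symm.sum_comp fun j => a j • expChar (freq j)).symm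

/-! ### Fejér operators attached to a finite set of frequencies -/

/-- The Bochner–Fejér operator with kernel `|∑ b ∈ B, exp (i b t)|² / #B`. -/
noncomputable def bochnerFejer (B : Finset ℝ) : (ℝ →ᵇ ℂ) →ₗ[ℂ] (ℝ →ᵇ ℂ) where
  toFun f := (B.card : ℂ)⁻¹ • ∑ p ∈ B ×ˢ B,
    bohrMean (f * expChar (-(p.1 - p.2))) • expChar (p.1 - p.2)
  map_add' f g := by
    simp only [add_mul, map_add, add_smul, Finset.sum_add_distrib, smul_add]
  map_smul' c f := by
    simp only [smul_mul_assoc, map_smul, smul_assoc, ← Finset.smul_sum, RingHom.id_apply]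
    rw [smul_comm]

lemma bochnerFejer_apply (B : Finset ℝ) (f : ℝ →ᵇ ℂ) :
    bochnerFejer B f = (B.card : ℂ)⁻¹ • ∑ p ∈ B ×ˢ B,
      bohrMean (f * expChar (-(p.1 - p.2))) • expChar (p.1 - p.2) := rfl

/-- The kernel `s ↦ |∑ b ∈ B, exp (i b (t - s))|² / #B`. -/
noncomputable def fejerKernel (B : Finset ℝ) (t : ℝ) : ℝ →ᵇ ℂ :=
  (B.card : ℂ)⁻¹ • ∑ p ∈ B ×ˢ B, expChar (p.1 - p.2) t • expChar (-(p.1 - p.2))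

lemma fejerKernel_apply (B : Finset ℝ) (t s : ℝ) :
    fejerKernel B t s = (((B.card : ℝ)⁻¹ * ‖∑ b ∈ B, expChar b (t - s)‖ ^ 2 : ℝ) : ℂ) := by
  push_cast
  rw [← mul_conj', map_sum, Finset.sum_mul_sum, ← Finset.sum_product']
  simp only [fejerKernel, BoundedContinuousFunction.coe_smul, BoundedContinuousFunction.coe_sum,
    Finset.sum_apply, smul_eq_mul, ← expChar_apply_sub, star_expChar_apply]
  congr 1
  refine Finset.sum_congr rfl fun p _ => ?_
  rw [sub_eq_add_neg p.1 p.2, ← expChar_mul]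
  rfl

lemma bohrMean_fejerKernel {B : Finset ℝ} (hB : B.Nonempty) (t : ℝ) :
    bohrMean (fejerKernel B t) = 1 := by
  have hcard : (B.card : ℂ) ≠ 0 := by simpa using hB.ne_empty
  have h : ∀ p ∈ B ×ˢ B, expChar (p.1 - p.2) t * bohrMean (expChar (-(p.1 - p.2))) =
      if p.1 = p.2 then 1 else 0 := by
    intro p _
    rw [bohrMean_expChar]
    by_cases hp : p.1 = p.2
    · simp [hp, expChar_zero]
    · rw [if_neg (neg_ne_zero.2 (sub_ne_zero.2 hp)), if_neg hp, mul_zero]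
  simp only [fejerKernel, map_smul, map_sum, smul_eq_mul]
  rw [Finset.sum_congr rfl h, Finset.sum_product]
  simp [hcard]

lemma bochnerFejer_apply_eq (B : Finset ℝ) (f : ℝ →ᵇ ℂ) (t : ℝ) :
    bochnerFejer B f t = bohrMean (f * fejerKernel B t) := by
  simp only [bochnerFejer_apply, fejerKernel, mul_smul_comm, Finset.mul_sum, map_smul, map_sum,
    BoundedContinuousFunction.coe_smul, BoundedContinuousFunction.coe_sum, Finset.sum_apply,
    smul_eq_mul]
  exact Finset.sum_congr rfl fun p _ => by ring

lemma norm_bochnerFejer_le {B : Finset ℝ} (hB : B.Nonempty) (f : ℝ →ᵇ ℂ) :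
    ‖bochnerFejer B f‖ ≤ ‖f‖ := by
  refine (BoundedContinuousFunction.norm_le (norm_nonneg f)).2 fun t => ?_
  rw [bochnerFejer_apply_eq]
  refine (norm_bohrMean_mul_le f _ fun s => ?_).trans_eq ?_
  · rw [fejerKernel_apply, norm_real, Real.norm_of_nonneg (by positivity)]
  · rw [bohrMean_fejerKernel hB, norm_one, mul_one]

/-- Orthogonality of characters keeps only the pairs with difference `lam`. The multiplier is near 1
when `B` is almost invariant under translation by `lam`. -/
lemma bochnerFejer_expChar (B : Finset ℝ) (lam : ℝ) :
    bochnerFejer B (expChar lam) =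
      (((B.filter fun b => b + lam ∈ B).card : ℂ) / B.card) • expChar lam := by
  have h : ∀ p ∈ B ×ˢ B, bohrMean (expChar lam * expChar (-(p.1 - p.2))) • expChar (p.1 - p.2) =
      if p.2 + lam = p.1 then expChar lam else 0 := by
    intro p _
    rw [expChar_mul, bohrMean_expChar]
    by_cases hp : p.2 + lam = p.1
    · have : p.1 - p.2 = lam := by linarith
      simp [hp, this]
    · have : ¬ lam + -(p.1 - p.2) = 0 := fun h => hp (by linarith)
      rw [if_neg this, if_neg hp, zero_smul]
  rw [bochnerFejer_apply, Finset.sum_congr rfl h, Finset.sum_product_right]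
  simp only [Finset.sum_ite_eq]
  rw [← Finset.sum_filter, Finset.sum_const, ← Nat.cast_smul_eq_nsmul ℂ, smul_smul]
  congr 1
  ring

/-! ### Følner sets in the additive group of the reals -/

/-- Otherwise `u n` would dominate `r ^ n`, contradicting polynomial growth. -/
lemma exists_card_succ_le {u : ℕ → ℕ} (hu : ∀ n, 0 < u n) (m : ℕ)
    (hbound : ∀ n, u n ≤ (n + 1) ^ m) {r : ℝ} (hr : 1 < r) :
    ∃ n, (u (n + 1) : ℝ) ≤ r * u n := by
  by_contra! h
  have hpow : ∀ n : ℕ, r ^ n ≤ u n := by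
    intro n
    induction n with
    | zero => simpa using Nat.one_le_iff_ne_zero.2 (hu 0).ne'
    | succ n ih =>
      rw [pow_succ']
      exact (mul_le_mul_of_nonneg_left ih (by linarith)).trans (h n).le
  have ht : Tendsto (fun n : ℕ => ((n + 1 : ℕ) : ℝ) ^ m / r ^ (n + 1)) atTop (𝓝 0) :=
    (tendsto_pow_const_div_const_pow_of_one_lt m hr).comp (tendsto_add_atTop_nat 1)
  obtain ⟨n, hn⟩ := (ht.eventually_lt_const (inv_pos.2 (zero_lt_one.trans hr))).exists
  have hrn : 0 < r ^ n := by positivity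
  have hr0 : 0 < r := by positivity
  rw [pow_succ, div_lt_iff₀ (by positivity), mul_comm (r ^ n), inv_mul_cancel_left₀ hr0.ne'] at hn
  have := (hpow n).trans (Nat.cast_le.2 (hbound n))
  push_cast at this hn
  linarith

/-- The sets are the values of integer combinations with coefficients in `[0, n]`. Coincidences
among the values only lower the cardinality, so no independence of the frequencies is required. -/
lemma exists_folner_finset {m : ℕ} (lam : Fin m → ℝ) {ε : ℝ} (hε : 0 < ε) :
    ∃ B : Finset ℝ, B.Nonempty ∧
      ∀ j, (1 - ε) * B.card ≤ (B.filter fun b => b + lam j ∈ B).card := by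
  classical
  let box : ℕ → Finset (Fin m → ℕ) := fun n => Fintype.piFinset fun _ => Finset.range (n + 1)
  let val : (Fin m → ℕ) → ℝ := fun c => ∑ j, c j * lam j
  let B : ℕ → Finset ℝ := fun n => (box n).image val
  have hmem : ∀ n c, c ∈ box n ↔ ∀ j, c j ≤ n := by
    intro n c
    simp [box]
  have hne : ∀ n, (B n).Nonempty := fun n =>
    ⟨val 0, Finset.mem_image_of_mem _ ((hmem n 0).2 fun j => Nat.zero_le _)⟩
  have hmono : ∀ n, B n ⊆ B (n + 1) := fun n =>
    Finset.image_subset_image fun c hc => (hmem _ c).2 fun j => ((hmem n c).1 hc j).trans n.le_succ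
  have hshift : ∀ n j, ∀ b ∈ B n, b + lam j ∈ B (n + 1) := by
    intro n j b hb
    obtain ⟨c, hc, rfl⟩ := Finset.mem_image.1 hb
    refine Finset.mem_image.2 ⟨c + Pi.single j 1, (hmem _ _).2 fun i => ?_, ?_⟩
    · have := (hmem n c).1 hc i
      by_cases hij : i = j
      · subst hij; simpa using this
      · simpa [hij] using this.trans n.le_succ
    · simp [val, add_mul, Finset.sum_add_distrib, Pi.single_apply]
  obtain ⟨n, hn⟩ := exists_card_succ_le (u := fun n => (B n).card) (fun n => (hne n).card_pos) m
    (fun n => Finset.card_image_le.trans (by simp [box])) (r := 1 + ε) (by linarith)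
  refine ⟨B n, hne n, fun j => ?_⟩
  -- The translates of the bad points avoid `B n` but lie in `B (n + 1)`, so there are at most `ε *
  -- (B n).card` of them.
  have hbad : ((B n).filter fun b => ¬ b + lam j ∈ B n).card + (B n).card ≤ (B (n + 1)).card := by
    rw [← Finset.card_image_of_injective _ (add_left_injective (lam j)),
      ← Finset.card_union_of_disjoint]
    · refine Finset.card_le_card (Finset.union_subset ?_ (hmono n))
      intro x hx
      obtain ⟨b, hb, rfl⟩ := Finset.mem_image.1 hx
      exact hshift n j b (Finset.mem_filter.1 hb).1
    · rw [Finset.disjoint_left]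
      intro x hx
      obtain ⟨b, hb, rfl⟩ := Finset.mem_image.1 hx
      exact (Finset.mem_filter.1 hb).2
  have hsplit := Finset.card_filter_add_card_filter_not (s := B n) fun b => b + lam j ∈ B n
  have h1 : (((B n).filter fun b => b + lam j ∈ B n).card : ℝ) +
      ((B n).filter fun b => ¬ b + lam j ∈ B n).card = (B n).card := by exact_mod_cast hsplit
  have h2 : (((B n).filter fun b => ¬ b + lam j ∈ B n).card : ℝ) + (B n).card ≤
      (B (n + 1)).card := by exact_mod_cast hbad
  linarith

lemma norm_bochnerFejer_expChar_sub_le {B : Finset ℝ} (hB : B.Nonempty) {lam ε : ℝ}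
    (h : (1 - ε) * B.card ≤ (B.filter fun b => b + lam ∈ B).card) :
    ‖bochnerFejer B (expChar lam) - expChar lam‖ ≤ ε := by
  have hpos : (0 : ℝ) < B.card := by exact_mod_cast hB.card_pos
  have hle : ((B.filter fun b => b + lam ∈ B).card : ℝ) ≤ B.card := by
    exact_mod_cast Finset.card_filter_le _ _
  set q : ℝ := ((B.filter fun b => b + lam ∈ B).card : ℝ) / B.card with hq
  have hq1 : q ≤ 1 := (div_le_one hpos).2 hle
  have hq2 : 1 - ε ≤ q := (le_div_iff₀ hpos).2 h
  have heq : bochnerFejer B (expChar lam) - expChar lam = ((q - 1 : ℝ) : ℂ) • expChar lam := by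
    rw [bochnerFejer_expChar, hq]
    push_cast
    rw [sub_smul, one_smul]
  rw [heq, norm_smul, norm_real, Real.norm_of_nonpos (by linarith)]
  refine (mul_le_of_le_one_right (by linarith) (norm_expChar_le lam)).trans (by linarith)

/-- Almost periodic functions are approximated by their Bochner–Fejér sums. -/
lemma exists_norm_bochnerFejer_sub_lt {f : ℝ →ᵇ ℂ} (hf : f ∈ AP) {ε : ℝ} (hε : 0 < ε) :
    ∃ B : Finset ℝ, B.Nonempty ∧ ‖bochnerFejer B f - f‖ < ε := by
  obtain ⟨Q, hQ, hfQ⟩ := Metric.mem_closure_iff.1 hf (ε / 4) (by positivity)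
  obtain ⟨n, -, a, lam, -, rfl⟩ := mem_genTrigPoly_iff.1 hQ
  set Q := ∑ j, a j • expChar (lam j) with hQdef
  set A : ℝ := ∑ j, ‖a j‖ with hA
  have hA0 : 0 ≤ A := Finset.sum_nonneg fun j _ => norm_nonneg _
  obtain ⟨B, hB, hBlam⟩ := exists_folner_finset lam (ε := ε / (4 * (A + 1))) (by positivity)
  refine ⟨B, hB, ?_⟩
  rw [dist_eq_norm] at hfQ
  have h1 : ‖bochnerFejer B Q - Q‖ ≤ ε / 4 := by
    rw [hQdef, map_sum, ← Finset.sum_sub_distrib]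
    calc ‖∑ j, (bochnerFejer B (a j • expChar (lam j)) - a j • expChar (lam j))‖
        ≤ ∑ j, ‖a j‖ * (ε / (4 * (A + 1))) := by
          refine norm_sum_le_of_le _ fun j _ => ?_
          rw [map_smul, ← smul_sub, norm_smul]
          exact mul_le_mul_of_nonneg_left (norm_bochnerFejer_expChar_sub_le hB (hBlam j))
            (norm_nonneg _)
      _ = A * (ε / (4 * (A + 1))) := by rw [← Finset.sum_mul]
      _ ≤ (A + 1) * (ε / (4 * (A + 1))) := by gcongr; linarith
      _ = ε / 4 := by field_simp
  have h2 : ‖bochnerFejer B (f - Q)‖ < ε / 4 := (norm_bochnerFejer_le hB _).trans_lt hfQ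
  have heq : bochnerFejer B f - f = bochnerFejer B (f - Q) + (bochnerFejer B Q - Q) - (f - Q) := by
    rw [map_sub]
    abel
  rw [heq]
  calc _ ≤ ‖bochnerFejer B (f - Q)‖ + ‖bochnerFejer B Q - Q‖ + ‖f - Q‖ :=
        (norm_sub_le _ _).trans (by gcongr; exact norm_add_le _ _)
    _ < ε := by linarith

/-! ### Vanishing of the negative Fourier coefficients -/

/-- Cauchy's theorem on the rectangle `[0, R] × [0, Y]` for a function which decays upwards. -/
lemma norm_integral_le_of_upper_half_plane {G : ℂ → ℂ} {M nu R Y : ℝ} (hR : 0 ≤ R) (hY : 0 < Y)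
    (hnu : 0 ≤ nu) (hM : 0 ≤ M)
    (hd : DifferentiableOn ℂ G {z : ℂ | 0 < z.im}) (hc : ContinuousOn G {z : ℂ | 0 ≤ z.im})
    (hb : ∀ z : ℂ, 0 < z.im → ‖G z‖ ≤ M * Real.exp (-(nu * z.im))) :
    ‖∫ x in (0 : ℝ)..R, G x‖ ≤ M * Real.exp (-(nu * Y)) * R + 2 * (M * Y) := by
  have hrect := integral_boundary_rect_eq_zero_of_continuousOn_of_differentiableOn G 0 (R + Y * I)
    (hc.mono fun z hz => by
      have := hz.2
      simp [Set.uIcc_of_le hY.le] at this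
      exact this.1)
    (hd.mono fun z hz => by
      have := hz.2
      simp [hY.le] at this
      exact this.1)
  simp only [zero_re, zero_im, add_re, add_im, ofReal_re, ofReal_im, mul_re, mul_im, I_re, I_im,
    mul_zero, mul_one, zero_mul, sub_zero, add_zero, zero_add, ofReal_zero, smul_eq_mul] at hrect
  have htop : ‖∫ x in (0 : ℝ)..R, G (x + Y * I)‖ ≤ M * Real.exp (-(nu * Y)) * R := by
    have := intervalIntegral.norm_integral_le_of_norm_le_const
      (f := fun x : ℝ => G (x + Y * I)) (a := 0) (b := R) (C := M * Real.exp (-(nu * Y)))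
      fun x _ => by simpa using hb (x + Y * I) (by simpa using hY)
    simpa [abs_of_nonneg hR] using this
  have hside : ∀ r : ℝ, ‖I * ∫ y in (0 : ℝ)..Y, G (r + y * I)‖ ≤ M * Y := by
    intro r
    have := intervalIntegral.norm_integral_le_of_norm_le_const
      (f := fun y : ℝ => G (r + y * I)) (a := 0) (b := Y) (C := M) fun y hy => by
        rw [Set.uIoc_of_le hY.le] at hy
        refine (hb (r + y * I) (by simpa using hy.1)).trans (mul_le_of_le_one_right hM ?_)
        rw [Real.exp_le_one_iff]
        simpa using mul_nonneg hnu hy.1.le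
    simpa [abs_of_pos hY] using this
  have hside0 := hside 0
  simp only [ofReal_zero, zero_add] at hside0
  have heq : ∫ x in (0 : ℝ)..R, G x = (∫ x in (0 : ℝ)..R, G (x + Y * I)) -
      I * (∫ y in (0 : ℝ)..Y, G (R + y * I)) + I * ∫ y in (0 : ℝ)..Y, G (y * I) := by
    linear_combination hrect
  rw [heq]
  calc _ ≤ ‖∫ x in (0 : ℝ)..R, G (x + Y * I)‖ + ‖I * (∫ y in (0 : ℝ)..Y, G (R + y * I))‖ +
        ‖I * ∫ y in (0 : ℝ)..Y, G (y * I)‖ :=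
        (norm_add_le _ _).trans (by gcongr; exact norm_sub_le _ _)
    _ ≤ _ := by linarith [hside R]

lemma bohrMean_mul_expChar_eq_zero {f : ℝ →ᵇ ℂ} (hf : HasBoundedHolomorphicExtension f) {nu : ℝ}
    (hnu : 0 < nu) : bohrMean (f * expChar nu) = 0 := by
  obtain ⟨F, hd, ⟨M, hM⟩, hc, hF⟩ := hf
  have hM0 : 0 ≤ M := (norm_nonneg _).trans (hM I (by simp))
  set G : ℂ → ℂ := fun z => F z * exp (I * nu * z) with hG
  have hE : Differentiable ℂ fun z : ℂ => exp (I * nu * z) := by fun_prop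
  have hGb : ∀ z : ℂ, 0 < z.im → ‖G z‖ ≤ M * Real.exp (-(nu * z.im)) := by
    intro z hz
    simp only [hG, norm_mul, norm_exp]
    have hre : (I * nu * z).re = -(nu * z.im) := by simp
    rw [hre]
    exact mul_le_mul_of_nonneg_right (hM z hz) (Real.exp_pos _).le
  have hlim : Tendsto (fun R : ℝ => M * Real.exp (-(nu * √R)) + 2 * M * (√R)⁻¹) atTop (𝓝 0) := by
    have h1 : Tendsto (fun R : ℝ => Real.exp (-(nu * √R))) atTop (𝓝 0) :=
      Real.tendsto_exp_neg_atTop_nhds_zero.comp (Real.tendsto_sqrt_atTop.const_mul_atTop hnu)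
    have h2 : Tendsto (fun R : ℝ => (√R)⁻¹) atTop (𝓝 0) :=
      tendsto_inv_atTop_zero.comp Real.tendsto_sqrt_atTop
    simpa using (h1.const_mul M).add (h2.const_mul (2 * M))
  refine bohrMean_eq_of_tendsto (squeeze_zero_norm' ?_ hlim)
  filter_upwards [eventually_gt_atTop 0] with R hR
  have hint : ∫ s in (0 : ℝ)..R, (f * expChar nu) s = ∫ s in (0 : ℝ)..R, G s :=
    intervalIntegral.integral_congr fun s _ => by
      simp [hG, hF, expChar_apply]
  have hs : 0 < √R := Real.sqrt_pos.2 hR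
  -- The height `√R` tends to infinity, yet is `o(R)`, so the top and the sides are both negligible
  -- after division by `R`.
  have key := norm_integral_le_of_upper_half_plane hR.le hs hnu.le hM0
    (hd.mul hE.differentiableOn) (hc.mul hE.continuous.continuousOn) hGb
  rw [intervalMean, hint, norm_mul, norm_inv, norm_real, Real.norm_of_nonneg hR.le,
    inv_mul_le_iff₀ hR]
  refine key.trans_eq ?_
  have hsq : R * (√R)⁻¹ = √R := by
    rw [← div_eq_mul_inv, Real.div_sqrt]
  linear_combination (-2 * M) * hsq

lemma bochnerFejer_mem_genTrigPoly {f : ℝ →ᵇ ℂ} (hf : HasBoundedHolomorphicExtension f)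
    {B : Finset ℝ} (hB : B.Nonempty) : bochnerFejer B f ∈ genTrigPoly (Set.Ici 0) := by
  have hne : Nonempty ↥(B ×ˢ B) := (hB.product hB).to_subtype
  -- Truncating the frequency at 0 changes only terms whose coefficient vanishes.
  have heq : bochnerFejer B f = ∑ p : ↥(B ×ˢ B),
      ((B.card : ℂ)⁻¹ * bohrMean (f * expChar (-(p.1.1 - p.1.2)))) •
        expChar (max (p.1.1 - p.1.2) 0) := by
    rw [bochnerFejer_apply, Finset.smul_sum, ← Finset.sum_coe_sort]
    refine Finset.sum_congr rfl fun p _ => ?_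
    rw [smul_smul]
    rcases le_or_gt 0 (p.1.1 - p.1.2) with h | h
    · rw [max_eq_left h]
    · rw [bohrMean_mul_expChar_eq_zero hf (neg_pos.2 h), mul_zero, zero_smul, zero_smul]
  rw [heq]
  exact sum_smul_expChar_mem_genTrigPoly _ _ fun p => Set.mem_Ici.2 (le_max_right _ _)

/-! ### Extension of analytic almost periodic functions -/

/-- A bounded holomorphic function on the upper half-plane which is continuous up to the boundary
satisfies the maximum principle. -/
lemma norm_le_of_bounded_upper_half_plane {F : ℂ → ℂ} {M C : ℝ}
    (hd : DifferentiableOn ℂ F {z : ℂ | 0 < z.im}) (hc : ContinuousOn F {z : ℂ | 0 ≤ z.im})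
    (hM : ∀ z : ℂ, 0 < z.im → ‖F z‖ ≤ M) (hC : ∀ x : ℝ, ‖F x‖ ≤ C) {z : ℂ} (hz : 0 ≤ z.im) :
    ‖F z‖ ≤ C := by
  have hrot : Differentiable ℂ fun w : ℂ => I * w := by fun_prop
  have hG : DiffContOnCl ℂ (fun w => F (I * w)) {w : ℂ | 0 < w.re} := by
    refine ⟨hd.comp hrot.differentiableOn fun w hw => by simpa using hw, ?_⟩
    rw [closure_setOfPred_lt_re]
    exact hc.comp hrot.continuous.continuousOn fun w hw => by simpa using hw
  -- Boundedness is growth of order `1 < 2` with constant 0 in the exponent.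
  have key := PhragmenLindelof.right_half_plane_of_bounded_on_real (C := C) (z := -I * z) hG
    ⟨1, by norm_num, 0, ?_⟩ ?_ ?_ (by simpa using hz)
  · simpa [← mul_assoc] using key
  · refine Asymptotics.IsBigO.of_bound M ?_
    refine eventually_inf_principal.2 (Eventually.of_forall fun w hw => ?_)
    simpa using hM (I * w) (by simpa using hw)
  · refine ⟨M, ?_⟩
    rw [eventually_map]
    filter_upwards [eventually_gt_atTop 0] with x hx
    exact hM (I * x) (by simpa using hx)
  · intro x
    have h : I * (x * I) = ((-x : ℝ) : ℂ) := by
      push_cast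
      linear_combination (x : ℂ) * I_mul_I
    rw [h]
    exact hC _

lemma exists_extension_of_mem_genTrigPoly {Q : ℝ →ᵇ ℂ} (hQ : Q ∈ genTrigPoly (Set.Ici 0)) :
    HasBoundedHolomorphicExtension Q := by
  obtain ⟨n, -, a, lam, hlam, hQ⟩ := hQ
  have hdiff : Differentiable ℂ fun z : ℂ => ∑ j, a j * exp (I * (lam j : ℂ) * z) := by fun_prop
  refine ⟨_, hdiff.differentiableOn, ⟨∑ j, ‖a j‖, fun z hz => ?_⟩, hdiff.continuous.continuousOn,
    fun x => (hQ x).symm⟩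
  refine norm_sum_le_of_le _ fun j _ => ?_
  rw [norm_mul, norm_exp]
  refine mul_le_of_le_one_right (norm_nonneg _) (Real.exp_le_one_iff.2 ?_)
  have := mul_nonneg (hlam j) hz.le
  simpa using this

/-- Bounded holomorphic extendability is preserved by uniform limits. -/
lemma isClosed_hasBoundedHolomorphicExtension :
    IsClosed {f : ℝ →ᵇ ℂ | HasBoundedHolomorphicExtension f} := by
  refine isSeqClosed_iff_isClosed.1 fun u f hu hlim => ?_
  choose E hd hb hc hE using hu
  choose M hM using hb
  -- The maximum principle, applied to differences, carries Cauchyness from the line to the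
  -- half-plane.
  have hdist : ∀ n m, ∀ z : ℂ, 0 ≤ z.im → dist (E n z) (E m z) ≤ dist (u n) (u m) := by
    intro n m z hz
    rw [dist_eq_norm]
    refine norm_le_of_bounded_upper_half_plane (F := fun z => E n z - E m z) (M := M n + M m)
      ((hd n).sub (hd m)) ((hc n).sub (hc m))
      (fun w hw => (norm_sub_le _ _).trans (add_le_add (hM n w hw) (hM m w hw)))
      (fun x => ?_) hz
    simp only [hE, ← dist_eq_norm]
    exact BoundedContinuousFunction.dist_coe_le_dist x
  have hcau : UniformCauchySeqOn E atTop {z : ℂ | 0 ≤ z.im} := by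
    refine Metric.uniformCauchySeqOn_iff.2 fun ε hε => ?_
    obtain ⟨N, hN⟩ := Metric.cauchySeq_iff.1 hlim.cauchySeq ε hε
    exact ⟨N, fun m hm n hn z hz => (hdist m n z hz).trans_lt (hN m hm n hn)⟩
  have hpt : ∀ z : ℂ, ∃ w, 0 ≤ z.im → Tendsto (fun n => E n z) atTop (𝓝 w) := by
    intro z
    by_cases hz : 0 ≤ z.im
    · obtain ⟨w, hw⟩ := cauchySeq_tendsto_of_complete (hcau.cauchySeq hz)
      exact ⟨w, fun _ => hw⟩
    · exact ⟨0, fun h => absurd h hz⟩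
  choose F hF using hpt
  have hunif : TendstoUniformlyOn E F atTop {z : ℂ | 0 ≤ z.im} :=
    hcau.tendstoUniformlyOn_of_tendsto hF
  refine ⟨F, ?_, ⟨‖f‖, fun z hz => ?_⟩, ?_, fun x => ?_⟩
  · have hsub : {z : ℂ | 0 < z.im} ⊆ {z : ℂ | 0 ≤ z.im} := fun z (hz : 0 < z.im) => hz.le
    exact (hunif.mono hsub).tendstoLocallyUniformlyOn.differentiableOn
      (Eventually.of_forall hd) (isOpen_lt continuous_const continuous_im)
  · refine le_of_tendsto_of_tendsto' (hF z hz.le).norm hlim.norm fun n => ?_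
    exact norm_le_of_bounded_upper_half_plane (hd n) (hc n) (hM n)
      (fun x => by rw [hE]; exact (u n).norm_coe_le_norm x) hz.le
  · exact hunif.continuousOn (Frequently.of_forall hc)
  · refine tendsto_nhds_unique (hF x (by simp)) ?_
    simp only [hE]
    exact ((continuous_eval_const (F := ℝ →ᵇ ℂ) x).tendsto f).comp hlim

lemma genTrigPoly_mono {L L' : Set ℝ} (h : L ⊆ L') : genTrigPoly L ⊆ genTrigPoly L' := by
  rintro Q ⟨n, hn, a, lam, hlam, hQ⟩
  exact ⟨n, hn, a, lam, fun j => h (hlam j), hQ⟩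

end AlmostPeriodic

theorem mainTheorem7 :
    APPlus = {f : ℝ →ᵇ ℂ | f ∈ AP ∧ HasBoundedHolomorphicExtension f} := by
  refine Set.Subset.antisymm (fun f hf => ⟨?_, ?_⟩) ?_
  · exact closure_mono (genTrigPoly_mono (Set.subset_univ _)) hf
  · exact closure_minimal (fun Q hQ => exists_extension_of_mem_genTrigPoly hQ)
      isClosed_hasBoundedHolomorphicExtension hf
  · rintro f ⟨hf, hext⟩
    refine Metric.mem_closure_iff.2 fun ε hε => ?_
    obtain ⟨B, hB, hBf⟩ := exists_norm_bochnerFejer_sub_lt hf hε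
    exact ⟨_, bochnerFejer_mem_genTrigPoly hext hB, by rwa [dist_comm, dist_eq_norm]⟩
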